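/- A multicast network is a finite directed multigraph with unit-capacity links, a source node $s$, and a set $T$ of receivers with $s \notin T$. Its topology is the undirected simple graph obtained by forgetting link orientations and merging parallel links; the network is $K_q$-minor-free if its topology has no minor isomorphic to the complete graph $K_q$. A linear network code for two information flows over a finite field $\mathbb{F}$ assigns to each link $e$ a vector $f_e \in \mathbb{F}^2$, such that for each link $e$ leaving a node $u \neq s$ the vector $f_e$ lies in the span of the vectors of the links entering $u$ (links leaving $s$ may carry any vector), and such that for each receiver $t \in T$ the vectors of the links entering $t$ span $\mathbb{F}^2$. The minimum field size is the smallest order of a finite field over which such a code exists. There is an absolute constant $C > 0$ such that for every integer $q \ge 2$ and every acyclic $K_q$-minor-free multicast network in which the maximum flow from $s$ to each receiver is at least $2$, two information flows can be multicast by a linear network code over some finite field, and the minimum field size required to do so is at most $C\, q \log q$. -/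

import Mathlib

/-- `H` is a minor of `G`: there are pairwise disjoint (nonempty) connected vertex sets of `G`,
one for each vertex of `H`, such that adjacent vertices of `H` have branch sets that are joined
by an edge of `G`. -/
def IsGraphMinor {W V : Type*} (H : SimpleGraph W) (G : SimpleGraph V) : Prop :=
  ∃ B : W → Set V,
    (∀ w, (G.induce (B w)).Connected) ∧
    (∀ w w', w ≠ w' → Disjoint (B w) (B w')) ∧
    (∀ w w', H.Adj w w' → ∃ x ∈ B w, ∃ y ∈ B w', G.Adj x y)

/-- `G` has no minor isomorphic to the complete graph on `q` vertices. -/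
def IsCliqueMinorFree {V : Type*} (q : ℕ) (G : SimpleGraph V) : Prop :=
  ¬ IsGraphMinor (⊤ : SimpleGraph (Fin q)) G

/-- A multicast network: a directed multigraph with node type `V` and link type `E` (every link
has unit capacity), a source node, and a set of receivers not containing the source. -/
structure MulticastNetwork (V E : Type*) where
  /-- the node that a link leaves -/
  tail : E → V
  /-- the node that a link enters -/
  head : E → V
  /-- the source node -/
  source : V
  /-- the set of receivers -/
  receivers : Set V
  source_notMem : source ∉ receivers

namespace MulticastNetwork

variable {V E : Type*}

/-- There is a link from `u` to `v`. -/
def Link (N : MulticastNetwork V E) (u v : V) : Prop :=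
  ∃ e, N.tail e = u ∧ N.head e = v

/-- The network has no directed cycle (in particular no loop). -/
def IsAcyclic (N : MulticastNetwork V E) : Prop :=
  ∀ v, ¬ Relation.TransGen N.Link v v

/-- The topology of the network: its underlying undirected simple graph. -/
def topology (N : MulticastNetwork V E) : SimpleGraph V :=
  SimpleGraph.fromRel N.Link

section Flow

open Classical in
/-- The total of `f` over the links entering `v` minus the total over the links leaving `v`. -/
noncomputable def netInflow [Fintype E] (N : MulticastNetwork V E) (f : E → ℝ) (v : V) : ℝ :=
  (∑ e with N.head e = v, f e) - ∑ e with N.tail e = v, f e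

/-- `f` is a flow from the source to `t` in the network with unit link capacities. -/
def IsFlow [Fintype E] (N : MulticastNetwork V E) (t : V) (f : E → ℝ) : Prop :=
  (∀ e, 0 ≤ f e ∧ f e ≤ 1) ∧ ∀ v, v ≠ N.source → v ≠ t → N.netInflow f v = 0

/-- The max-flow `λ(t)` from the source to a node `t` (other than the source). -/
noncomputable def maxFlow [Fintype E] (N : MulticastNetwork V E) (t : V) : ℝ :=
  sSup {r : ℝ | ∃ f : E → ℝ, N.IsFlow t f ∧ N.netInflow f t = r}

end Flow

section Coding

/-- `vec` is a linear network code over `F` that multicasts `h` information flows. The symbol sent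
on the link `e` is the linear form with coefficient vector `vec e` in the `h` source symbols. Links
leaving the source carry arbitrary linear combinations of the source symbols, links leaving another
node carry linear combinations of the symbols on the links entering that node, and every receiver
can recover all `h` source symbols from the links entering it. -/
def IsLinearSolution (N : MulticastNetwork V E) (h : ℕ) (F : Type*) [Field F]
    (vec : E → Fin h → F) : Prop :=
  (∀ e, N.tail e ≠ N.source →
    vec e ∈ Submodule.span F {x | ∃ e', N.head e' = N.tail e ∧ vec e' = x}) ∧
  (∀ t ∈ N.receivers, Submodule.span F {x | ∃ e, N.head e = t ∧ vec e = x} = ⊤)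

/-- The orders of the finite fields over which linear coding suffices to multicast `h`
information flows. -/
def sufficientFieldSizes (N : MulticastNetwork V E) (h : ℕ) : Set ℕ :=
  {n | ∃ (F : Type) (_ : Field F) (_ : Fintype F),
    Fintype.card F = n ∧ ∃ vec : E → Fin h → F, N.IsLinearSolution h F vec}

/-- The minimum field size required to multicast `h` information flows (meaningful when some finite
field suffices). -/
noncomputable def minFieldSize (N : MulticastNetwork V E) (h : ℕ) : ℕ :=
  sInf (N.sufficientFieldSizes h)

end Coding

end MulticastNetwork

/-! The coding problem reduces to a graph colouring. Let each link leaving the source, or leaving a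
node entered by several flows (a mixing node), start a new flow, and let every other link forward
the single flow it receives. A cut argument shows that every receiver is a mixing node. Give the
flow `c` the vector `(1, x_c)`: two flows with different `x_c` span the plane. So it suffices to
choose two flows at each mixing node and to colour the resulting conflict graph properly with field
elements.

The nodes entered by `c` alone form a connected region. Attaching each mixing node to the region of
one of its two chosen flows exhibits the conflict graph, restricted to flows with nonempty region,
as a minor of the topology. The other flows have degree at most one. Hence greedy colouring works
once every nonempty `K_q`-minor-free graph has a vertex of degree `O(q log q)`.

That bound follows Mader's method. Deleting and contracting edges in a graph with `n` vertices and
at least `k * n` edges leads to a vertex whose neighbourhood has at most `2 * k` vertices and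
minimum degree at least `k`. A graph this dense has connected dominating sets of logarithmic size,
and removing `q` of them greedily gives the branch sets of `K_q`. If a small vertex set disconnects
the graph instead, a smallest remaining component is nearly complete and the same argument runs
there. -/

/-! ### Connected sets and transitivity of minors -/

namespace SimpleGraph

variable {V W X : Type*}

theorem Connected.induce_image {G : SimpleGraph V} {G' : SimpleGraph W} (f : G →g G') {S : Set V}
    (h : (G.induce S).Connected) : (G'.induce (f '' S)).Connected := by
  let g : G.induce S →g G'.induce (f '' S) :=
    { toFun := fun x => ⟨f x, x, x.2, rfl⟩
      map_rel' := fun {a b} hab => f.map_adj hab }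
  refine h.map g ?_
  rintro ⟨_, x, hx, rfl⟩
  exact ⟨⟨x, hx⟩, rfl⟩

theorem Reachable.induce_mono {G : SimpleGraph V} {S T : Set V} (hST : S ⊆ T) {x y : V}
    {hx : x ∈ S} {hy : y ∈ S} (h : (G.induce S).Reachable ⟨x, hx⟩ ⟨y, hy⟩) :
    (G.induce T).Reachable ⟨x, hST hx⟩ ⟨y, hST hy⟩ :=
  h.map (G.induceHomOfLE hST).toHom

/-- A walk in `C` lifts to the union: cross each branch set by its connectedness and pass to the
next one along an edge supplied by `hadj`. -/
theorem induce_biUnion_connected {G : SimpleGraph V} {H : SimpleGraph W} {C : Set W}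
    (hC : (H.induce C).Connected) {B : W → Set V}
    (hB : ∀ w ∈ C, (G.induce (B w)).Connected)
    (hadj : ∀ w ∈ C, ∀ w' ∈ C, H.Adj w w' → ∃ x ∈ B w, ∃ y ∈ B w', G.Adj x y) :
    (G.induce (⋃ w ∈ C, B w)).Connected := by
  have hsub : ∀ w ∈ C, B w ⊆ ⋃ w ∈ C, B w := fun w hw => Set.subset_biUnion_of_mem hw
  obtain ⟨w₀, hw₀⟩ := hC.nonempty
  obtain ⟨b₀, hb₀⟩ := (hB w₀ hw₀).nonempty
  have key : ∀ w : C, ∀ x (hx : x ∈ B w),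
      (G.induce (⋃ w ∈ C, B w)).Reachable ⟨b₀, hsub _ hw₀ hb₀⟩ ⟨x, hsub _ w.2 hx⟩ := by
    intro w
    have hr := (reachable_iff_reflTransGen _ _).1 (hC.preconnected ⟨w₀, hw₀⟩ w)
    induction hr with
    | refl =>
      intro x hx
      exact ((hB w₀ hw₀).preconnected ⟨b₀, hb₀⟩ ⟨x, hx⟩).induce_mono (hsub _ hw₀)
    | @tail u w _ huw ih =>
      intro x hx
      obtain ⟨y, hy, z, hz, hyz⟩ := hadj u u.2 w w.2 huw
      refine (ih y hy).trans (Reachable.trans (Adj.reachable ?_)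
        (((hB w w.2).preconnected ⟨z, hz⟩ ⟨x, hx⟩).induce_mono (hsub _ w.2)))
      exact hyz
  rw [connected_iff_exists_forall_reachable]
  refine ⟨⟨b₀, hsub _ hw₀ hb₀⟩, ?_⟩
  rintro ⟨x, hx⟩
  obtain ⟨w, hw, hxw⟩ := Set.mem_iUnion₂.1 hx
  exact key ⟨w, hw⟩ x hxw

end SimpleGraph

theorem IsGraphMinor.of_injective {V W : Type*} {H : SimpleGraph W} {G : SimpleGraph V}
    (f : H →g G) (hf : Function.Injective f) : IsGraphMinor H G := by
  refine ⟨fun w => {f w}, fun w => ?_, fun w w' h => ?_, fun w w' h => ?_⟩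
  · have : Subsingleton ({f w} : Set V) := by simp
    exact SimpleGraph.Connected.of_subsingleton
  · simpa using fun h' => h (hf h')
  · exact ⟨_, rfl, _, rfl, f.map_adj h⟩

theorem IsGraphMinor.trans {V W X : Type*} {K : SimpleGraph X} {H : SimpleGraph W}
    {G : SimpleGraph V} (h₁ : IsGraphMinor K H) (h₂ : IsGraphMinor H G) : IsGraphMinor K G := by
  obtain ⟨C, hC, hCd, hCa⟩ := h₁
  obtain ⟨B, hB, hBd, hBa⟩ := h₂
  refine ⟨fun x => ⋃ w ∈ C x, B w, fun x => ?_, fun x x' h => ?_, fun x x' h => ?_⟩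
  · exact SimpleGraph.induce_biUnion_connected (hC x) (fun w _ => hB w) (fun w _ w' _ => hBa w w')
  · simp only [Set.disjoint_iUnion_left, Set.disjoint_iUnion_right]
    intro w hw w' hw'
    apply hBd
    rintro rfl
    exact Set.disjoint_left.1 (hCd x x' h) hw' hw
  · obtain ⟨w, hw, w', hw', ha⟩ := hCa x x' h
    obtain ⟨y, hy, y', hy', ha'⟩ := hBa w w' ha
    exact ⟨y, Set.mem_biUnion hw hy, y', Set.mem_biUnion hw' hy', ha'⟩

/-! ### Small connected dominating sets in dense graphs -/

namespace SimpleGraph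

variable {V : Type*}

/-- Were the distance at least 6, then `x`, `y` and the vertex three steps along a geodesic would be
pairwise at distance at least 3. Their neighbourhoods would be disjoint and contain `3 * d` vertices
in total, which is too many. -/
theorem Connected.dist_le_five [Finite V] {G : SimpleGraph V} (hG : G.Connected) {d : ℕ}
    (hd : ∀ v, d ≤ (G.neighborSet v).ncard) (hn : Nat.card V < 3 * d) (x y : V) :
    G.dist x y ≤ 5 := by
  by_contra! hxy
  obtain ⟨p, hp⟩ := hG.exists_walk_length_eq_dist x y
  set a := p.getVert 3
  have h1 : G.dist x a ≤ 3 := (dist_le (p.take 3)).trans (by simp [Walk.take_length])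
  have h2 : G.dist a y ≤ p.length - 3 := (dist_le (p.drop 3)).trans (by simp [Walk.drop_length])
  have h3 := hG.dist_triangle (u := x) (v := a) (w := y)
  have hdisj : ∀ u v, 3 ≤ G.dist u v → Disjoint (G.neighborSet u) (G.neighborSet v) := by
    intro u v huv
    rw [Set.disjoint_left]
    intro z hz hz'
    have h4 := hG.dist_triangle (u := u) (v := z) (w := v)
    have h5 := dist_eq_one_iff_adj.2 hz
    have h6 := dist_eq_one_iff_adj.2 (Adj.symm hz')
    omega
  have e1 := hdisj x a (by omega)
  have e2 := hdisj a y (by omega)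
  have e3 := hdisj x y (by omega)
  have h7 : ((G.neighborSet x ∪ G.neighborSet a) ∪ G.neighborSet y).ncard ≤ Nat.card V := by
    rw [← Set.ncard_univ]
    exact Set.ncard_le_ncard (Set.subset_univ _)
  rw [Set.ncard_union_eq (Set.disjoint_union_left.2 ⟨e3, e2⟩), Set.ncard_union_eq e1] at h7
  have := hd x
  have := hd a
  have := hd y
  omega

/-- The vertices that are neither in `S` nor adjacent to a vertex of `S`. -/
def undominated (G : SimpleGraph V) (S : Set V) : Set V :=
  {v | v ∉ S ∧ ∀ s ∈ S, ¬ G.Adj s v}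

/-- Double counting: the average over `x` of the number of neighbours in `U` is at least `U.ncard *
d / n`, with `n` the order of the graph, and `d` exceeds `n / 3`. -/
theorem exists_large_inter_neighborSet [Finite V] {G : SimpleGraph V} {d : ℕ}
    (hd : ∀ v, d ≤ (G.neighborSet v).ncard) (hn : Nat.card V < 3 * d) {U : Set V}
    (hU : U.Nonempty) : ∃ x, U.ncard ≤ 3 * (G.neighborSet x ∩ U).ncard := by
  classical
  have := Fintype.ofFinite V
  by_contra! h
  have h1 : ∀ x, (G.neighborSet x ∩ U).ncard = ∑ u ∈ U.toFinset, if G.Adj x u then 1 else 0 := by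
    intro x
    rw [← Finset.card_filter, Set.ncard_eq_toFinset_card']
    congr 1
    ext u
    simp [and_comm]
  have h2 : ∀ u, (G.neighborSet u).ncard = ∑ x, if G.Adj x u then 1 else 0 := by
    intro u
    rw [← Finset.card_filter, Set.ncard_eq_toFinset_card']
    congr 1
    ext x
    simp [G.adj_comm]
  have h3 : ∑ x, (G.neighborSet x ∩ U).ncard = ∑ u ∈ U.toFinset, (G.neighborSet u).ncard := by
    simp_rw [h1, h2]
    exact Finset.sum_comm
  have h4 : U.ncard * d ≤ ∑ u ∈ U.toFinset, (G.neighborSet u).ncard := by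
    rw [Set.ncard_eq_toFinset_card', ← smul_eq_mul]
    exact Finset.card_nsmul_le_sum _ _ _ fun u _ => hd u
  have h5 : 3 * ∑ x, (G.neighborSet x ∩ U).ncard ≤ Fintype.card V * U.ncard := by
    rw [Finset.mul_sum, ← smul_eq_mul, ← Finset.card_univ]
    exact Finset.sum_le_card_nsmul _ _ _ fun x _ => (h x).le
  rw [Nat.card_eq_fintype_card] at hn
  have hpos : 0 < U.ncard := (Set.ncard_pos).2 hU
  nlinarith

/-- Each round joins `S` by a geodesic, hence by at most 6 vertices, to a vertex that dominates a
third of what is still undominated. -/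
theorem Connected.exists_connected_few_undominated [Finite V] {G : SimpleGraph V}
    (hG : G.Connected) {d : ℕ}
    (hd : ∀ v, d ≤ (G.neighborSet v).ncard) (hn : Nat.card V < 3 * d) (t : ℕ) :
    ∃ S : Set V, (G.induce S).Connected ∧ S.ncard ≤ 6 * t + 1 ∧
      (G.undominated S).ncard * 3 ^ t ≤ 2 ^ t * Nat.card V := by
  induction t with
  | zero =>
    obtain ⟨v⟩ := hG.nonempty
    refine ⟨{v}, ?_, by simp, ?_⟩
    · have : Subsingleton ({v} : Set V) := by simp
      exact Connected.of_subsingleton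
    · simpa using (Set.ncard_le_ncard (Set.subset_univ _)).trans (Set.ncard_univ V).le
  | succ t ih =>
    obtain ⟨S, hS, hScard, hSU⟩ := ih
    rcases (G.undominated S).eq_empty_or_nonempty with hU | hU
    · exact ⟨S, hS, by omega, by simp [hU]⟩
    obtain ⟨x, hx⟩ := exists_large_inter_neighborSet hd hn hU
    obtain ⟨⟨s, hs⟩⟩ := hS.nonempty
    obtain ⟨p, hp⟩ := hG.exists_walk_length_eq_dist s x
    have hp5 := hG.dist_le_five hd hn s x
    have hpc : {v | v ∈ p.support}.ncard ≤ 6 := by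
      classical
      have : {v | v ∈ p.support} = (p.support.toFinset : Set V) := by ext; simp
      rw [this, Set.ncard_coe_finset]
      refine (List.toFinset_card_le _).trans ?_
      rw [Walk.length_support]
      omega
    refine ⟨S ∪ {v | v ∈ p.support}, ?_, ?_, ?_⟩
    · exact induce_union_connected hS.preconnected p.connected_induce_support.preconnected
        ⟨s, hs, p.start_mem_support⟩
    · have := Set.ncard_union_le S {v | v ∈ p.support}
      omega
    · have hsub : G.undominated (S ∪ {v | v ∈ p.support}) ⊆
          G.undominated S \ (G.neighborSet x ∩ G.undominated S) := by
        rintro v ⟨hv1, hv2⟩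
        refine ⟨⟨fun h => hv1 (Or.inl h), fun s hs => hv2 s (Or.inl hs)⟩, fun h => ?_⟩
        exact hv2 x (Or.inr p.end_mem_support) h.1
      have h1 := Set.ncard_le_ncard hsub
      have h2 := Set.ncard_sdiff_add_ncard_of_subset
        (Set.inter_subset_right (s := G.neighborSet x) (t := G.undominated S))
      have h3 : 3 * (G.undominated (S ∪ {v | v ∈ p.support})).ncard ≤
        2 * (G.undominated S).ncard := by omega
      calc _ = (3 * (G.undominated (S ∪ {v | v ∈ p.support})).ncard) * 3 ^ t := by ring
        _ ≤ (2 * (G.undominated S).ncard) * 3 ^ t := Nat.mul_le_mul_right _ h3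
        _ = 2 * ((G.undominated S).ncard * 3 ^ t) := by ring
        _ ≤ 2 * (2 ^ t * Nat.card V) := Nat.mul_le_mul_left _ hSU
        _ = _ := by ring

theorem Connected.exists_connected_dominating [Finite V] {G : SimpleGraph V}
    (hG : G.Connected) {d L : ℕ}
    (hd : ∀ v, d ≤ (G.neighborSet v).ncard) (hn : Nat.card V < 3 * d) (hL : Nat.card V < 2 ^ L) :
    ∃ S : Set V, (G.induce S).Connected ∧ S.ncard ≤ 12 * L + 1 ∧
      ∀ v ∉ S, ∃ s ∈ S, G.Adj s v := by
  -- After `2 * L` rounds fewer than one vertex is left undominated, because `(4 / 9) ^ L * 2 ^ L ≤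
  -- 1`.
  obtain ⟨S, hS, hc, hU⟩ := hG.exists_connected_few_undominated hd hn (2 * L)
  refine ⟨S, hS, by omega, ?_⟩
  by_contra! h
  obtain ⟨v, hv⟩ := h
  have hpos : 0 < (G.undominated S).ncard := (Set.ncard_pos).2 ⟨v, hv⟩
  have h1 : (3 : ℕ) ^ (2 * L) ≤ 2 ^ (2 * L) * Nat.card V := by nlinarith [Nat.zero_le (3 ^ (2 * L))]
  have h2 : (2 : ℕ) ^ (2 * L) * 2 ^ L ≤ 3 ^ (2 * L) := by
    rw [pow_mul, pow_mul, ← mul_pow]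
    exact Nat.pow_le_pow_left (by norm_num) _
  have h3 : (2 : ℕ) ^ (2 * L) * Nat.card V < 2 ^ (2 * L) * 2 ^ L :=
    Nat.mul_lt_mul_of_pos_left hL (by positivity)
  omega

end SimpleGraph

/-! ### Clique minors in dense graphs -/

namespace SimpleGraph

variable {V : Type*}

theorem image_val_neighborSet_induce {G : SimpleGraph V} (S : Set V) (v : S) :
    Subtype.val '' (G.induce S).neighborSet v = G.neighborSet v ∩ S := by
  ext x
  simp [and_comm]

theorem ncard_neighborSet_induce {G : SimpleGraph V} (S : Set V) (v : S) :
    ((G.induce S).neighborSet v).ncard = (G.neighborSet v ∩ S).ncard := by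
  rw [← image_val_neighborSet_induce, Set.ncard_image_of_injective _ Subtype.val_injective]

theorem ncard_neighborSet_le_induce_compl [Finite V] {G : SimpleGraph V} (R : Set V)
    (v : (Rᶜ : Set V)) :
    (G.neighborSet v).ncard ≤ ((G.induce Rᶜ).neighborSet v).ncard + R.ncard := by
  rw [ncard_neighborSet_induce]
  refine (Set.ncard_le_ncard (t := (G.neighborSet v ∩ Rᶜ) ∪ R) ?_).trans (Set.ncard_union_le _ _)
  intro x hx
  by_cases h : x ∈ R
  · exact Or.inr h
  · exact Or.inl ⟨hx, h⟩

/-- The branch sets are chosen greedily, each a small connected dominating set of what remains.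
Together they never exceed `m` vertices, so the remainder stays connected and dense. Each set
dominates all that lies outside the sets chosen so far, hence touches every later one. -/
theorem isGraphMinor_top_of_robust [Finite V] {G : SimpleGraph V} {D m q L : ℕ}
    (hd : ∀ v, D ≤ (G.neighborSet v).ncard) (hn : Nat.card V < 3 * (D - m))
    (hL : Nat.card V < 2 ^ L) (hm : q * (12 * L + 1) ≤ m)
    (hrob : ∀ R : Set V, R.ncard ≤ m → (G.induce Rᶜ).Connected) :
    IsGraphMinor (⊤ : SimpleGraph (Fin q)) G := by
  have key : ∀ j ≤ q, ∃ B : ℕ → Set V,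
      (∀ i < j, (G.induce (B i)).Connected) ∧
      (⋃ i < j, B i).ncard ≤ j * (12 * L + 1) ∧
      (∀ i < j, ∀ i' < i, Disjoint (B i') (B i) ∧ ∃ x ∈ B i', ∃ y ∈ B i, G.Adj x y) ∧
      (∀ i < j, ∀ v ∉ ⋃ i < j, B i, ∃ x ∈ B i, G.Adj x v) := by
    intro j
    induction j with
    | zero => exact fun _ => ⟨fun _ => ∅, by simp⟩
    | succ j ih =>
      intro hj
      obtain ⟨B, hBc, hBn, hBd, hBdom⟩ := ih (by omega)
      set R := ⋃ i < j, B i with hR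
      have hRm : R.ncard ≤ m :=
        hBn.trans ((Nat.mul_le_mul_right _ (by omega)).trans hm)
      have hcard : Nat.card (Rᶜ : Set V) ≤ Nat.card V := Finite.card_subtype_le _
      obtain ⟨S, hS, hSc, hSd⟩ := (hrob R hRm).exists_connected_dominating (d := D - m) (L := L)
        (fun v => by
          have := ncard_neighborSet_le_induce_compl (G := G) R v
          have := hd v
          omega) (by omega) (by omega)
      have hTc := hS.induce_image (Embedding.induce (G := G) Rᶜ).toHom
      set T : Set V := Subtype.val '' S with hT
      have hTR : ∀ x ∈ T, x ∉ R := by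
        rintro _ ⟨x, _, rfl⟩
        exact x.2
      have hun : (⋃ i < j + 1, Function.update B j T i) = R ∪ T := by
        ext x
        simp only [Set.mem_iUnion, hR, Set.mem_union]
        constructor
        · rintro ⟨i, hi, hx⟩
          rcases eq_or_ne i j with rfl | hij
          · right; simpa using hx
          · left; exact ⟨i, by omega, by simpa [hij] using hx⟩
        · rintro (⟨i, hi, hx⟩ | hx)
          · exact ⟨i, by omega, by simpa [hi.ne] using hx⟩
          · exact ⟨j, by omega, by simpa using hx⟩
      refine ⟨Function.update B j T, ?_, ?_, ?_, ?_⟩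
      · intro i hi
        rcases eq_or_ne i j with rfl | hij
        · rw [Function.update_self]; exact hTc
        · rw [Function.update_of_ne hij]; exact hBc i (by omega)
      · rw [hun]
        have h1 := Set.ncard_union_le R T
        have h2 : T.ncard ≤ 12 * L + 1 := by
          rw [hT, Set.ncard_image_of_injective _ Subtype.val_injective]; exact hSc
        rw [Nat.succ_mul]
        omega
      · intro i hi i' hi'
        rw [Function.update_of_ne (show i' ≠ j by omega)]
        rcases eq_or_ne i j with rfl | hij
        · rw [Function.update_self]
          refine ⟨Set.disjoint_right.2 fun x hx hx' => hTR x hx (Set.mem_biUnion hi' hx'), ?_⟩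
          obtain ⟨⟨y, hy⟩⟩ := hTc.nonempty
          obtain ⟨x, hx, hxy⟩ := hBdom i' hi' y (hTR y hy)
          exact ⟨x, hx, y, hy, hxy⟩
        · rw [Function.update_of_ne hij]
          exact hBd i (by omega) i' hi'
      · intro i hi v hv
        rw [hun, Set.mem_union, not_or] at hv
        rcases eq_or_ne i j with rfl | hij
        · rw [Function.update_self]
          obtain ⟨s, hs, hsv⟩ := hSd ⟨v, hv.1⟩ (fun h => hv.2 ⟨_, h, rfl⟩)
          exact ⟨s, ⟨s, hs, rfl⟩, hsv⟩
        · rw [Function.update_of_ne hij]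
          exact hBdom i (by omega) v hv.1
  obtain ⟨B, hBc, -, hBd, -⟩ := key q le_rfl
  refine ⟨fun i => B i, fun i => hBc i i.2, fun i i' h => ?_, fun i i' h => ?_⟩
  · rcases lt_or_gt_of_ne (Fin.val_ne_of_ne h) with h | h
    · exact (hBd i' i'.2 i h).1
    · exact (hBd i i.2 i' h).1.symm
  · rcases lt_or_gt_of_ne (Fin.val_ne_of_ne h.ne) with h | h
    · exact (hBd i' i'.2 i h).2
    · obtain ⟨x, hx, y, hy, hxy⟩ := (hBd i i.2 i' h).2
      exact ⟨y, hy, x, hx, hxy.symm⟩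

/-- If all degrees exceed half the order, the graph is connected. -/
theorem connected_of_card_lt_two_mul [Finite V] [Nonempty V] {G : SimpleGraph V} {d : ℕ}
    (hd : ∀ v, d ≤ (G.neighborSet v).ncard) (hn : Nat.card V < 2 * d) : G.Connected := by
  refine ⟨fun x y => ?_⟩
  have h1 : (G.neighborSet x ∩ G.neighborSet y).Nonempty := by
    rw [← Set.not_disjoint_iff_nonempty_inter]
    intro h
    have h2 : (G.neighborSet x ∪ G.neighborSet y).ncard ≤ Nat.card V := by
      rw [← Set.ncard_univ]
      exact Set.ncard_le_ncard (Set.subset_univ _)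
    rw [Set.ncard_union_eq h] at h2
    have := hd x
    have := hd y
    omega
  obtain ⟨z, hz, hz'⟩ := h1
  exact (Adj.reachable hz).trans (Adj.reachable hz').symm

theorem isGraphMinor_top_of_nearly_complete [Finite V] [Nonempty V] {G : SimpleGraph V}
    {k m q L : ℕ}
    (hd : ∀ v, k - m ≤ (G.neighborSet v).ncard) (hn : Nat.card V ≤ k)
    (hL : Nat.card V < 2 ^ L) (hm : q * (12 * L + 1) ≤ m) (hk : 4 * m < k) :
    IsGraphMinor (⊤ : SimpleGraph (Fin q)) G := by
  refine isGraphMinor_top_of_robust hd (by omega) hL hm fun R hR => ?_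
  have hdeg : ∀ v : (Rᶜ : Set V), k - m - m ≤ ((G.induce Rᶜ).neighborSet v).ncard := fun v => by
    have := ncard_neighborSet_le_induce_compl (G := G) R v
    have := hd v
    omega
  have hne : Nonempty (Rᶜ : Set V) := by
    rw [Set.nonempty_coe_sort, Set.nonempty_compl]
    rintro rfl
    have v : V := Classical.arbitrary V
    have h1 := hd v
    have h2 := Set.ncard_le_ncard (Set.subset_univ (G.neighborSet v))
    omega
  have hcard : Nat.card (Rᶜ : Set V) ≤ Nat.card V := Finite.card_subtype_le _
  exact connected_of_card_lt_two_mul hdeg (by omega)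

/-- If deleting some `m` vertices disconnects the graph, one of two components has at most half of
the `2 * k` vertices, yet its degrees are still at least `k - m`: it is nearly complete. -/
theorem isGraphMinor_top_of_dense [Finite V] [Nonempty V] {G : SimpleGraph V} {k m q L : ℕ}
    (hd : ∀ v, k ≤ (G.neighborSet v).ncard) (hn : Nat.card V ≤ 2 * k)
    (hL : 2 * k < 2 ^ L) (hm : q * (12 * L + 1) ≤ m) (hk : 4 * m < k) :
    IsGraphMinor (⊤ : SimpleGraph (Fin q)) G := by
  by_cases hrob : ∀ R : Set V, R.ncard ≤ m → (G.induce Rᶜ).Connected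
  · exact isGraphMinor_top_of_robust hd (by omega) (by omega) hm hrob
  push Not at hrob
  obtain ⟨R, hR, hRc⟩ := hrob
  have hne : Nonempty (Rᶜ : Set V) := by
    rw [Set.nonempty_coe_sort, Set.nonempty_compl]
    rintro rfl
    have v : V := Classical.arbitrary V
    have h1 := hd v
    have h2 := Set.ncard_le_ncard (Set.subset_univ (G.neighborSet v))
    omega
  have hpre : ¬ (G.induce Rᶜ).Preconnected := fun h => hRc ⟨h⟩
  simp only [Preconnected, not_forall] at hpre
  obtain ⟨x, y, hxy⟩ := hpre
  have hcard : Nat.card (Rᶜ : Set V) ≤ Nat.card V := Finite.card_subtype_le _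
  set H := G.induce Rᶜ
  have hcomp : ∃ z, {w | H.Reachable z w}.ncard ≤ k := by
    by_contra! h
    have h1 := h x
    have h2 := h y
    have h3 : Disjoint {w | H.Reachable x w} {w | H.Reachable y w} :=
      Set.disjoint_left.2 fun w hw hw' => hxy (Reachable.trans hw (Reachable.symm hw'))
    have h4 : ({w | H.Reachable x w} ∪ {w | H.Reachable y w}).ncard ≤ Nat.card (Rᶜ : Set V) := by
      rw [← Set.ncard_univ]
      exact Set.ncard_le_ncard (Set.subset_univ _)
    rw [Set.ncard_union_eq h3] at h4
    omega
  obtain ⟨z, hz⟩ := hcomp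
  set C := {w | H.Reachable z w}
  have hCne : Nonempty C := ⟨⟨z, Reachable.refl z⟩⟩
  rw [← Nat.card_coe_set_eq] at hz
  have hdC : ∀ v : C, k - m ≤ ((H.induce C).neighborSet v).ncard := by
    intro v
    rw [ncard_neighborSet_induce, Set.inter_eq_left.2]
    · have : (G.neighborSet v).ncard ≤ (H.neighborSet v).ncard + R.ncard :=
        ncard_neighborSet_le_induce_compl R v
      have := hd v
      omega
    · intro w hw
      exact Reachable.trans v.2 (Adj.reachable hw)
  have h1 : IsGraphMinor (⊤ : SimpleGraph (Fin q)) (H.induce C) :=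
    isGraphMinor_top_of_nearly_complete hdC hz (by omega) hm hk
  have h2 : IsGraphMinor (H.induce C) H :=
    .of_injective (Embedding.induce C).toHom Subtype.val_injective
  have h3 : IsGraphMinor H G :=
    .of_injective (Embedding.induce (G := G) Rᶜ).toHom Subtype.val_injective
  exact (h1.trans h2).trans h3

end SimpleGraph

/-! ### Edge density, low-degree vertices and colouring -/

namespace SimpleGraph

/-- The ordered pairs of adjacent vertices. -/
def adjPairs {V : Type*} (G : SimpleGraph V) : Set (V × V) := {p | G.Adj p.1 p.2}

/-- The graph obtained by identifying the vertex `b` with the vertex `a`. -/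
def contract {V : Type*} (G : SimpleGraph V) (a b : V) : SimpleGraph {x // x ≠ b} where
  Adj x y := x ≠ y ∧ (G.Adj x y ∨ (x.1 = a ∧ G.Adj b y) ∨ (y.1 = a ∧ G.Adj x b))
  symm := ⟨by
    rintro x y ⟨h, h' | ⟨h', h''⟩ | ⟨h', h''⟩⟩
    · exact ⟨h.symm, Or.inl h'.symm⟩
    · exact ⟨h.symm, Or.inr (Or.inr ⟨h', h''.symm⟩)⟩
    · exact ⟨h.symm, Or.inr (Or.inl ⟨h', h''.symm⟩)⟩⟩
  loopless := ⟨fun x h => h.1 rfl⟩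

variable {V : Type*}

theorem isGraphMinor_contract {G : SimpleGraph V} {a b : V} (hab : G.Adj a b) :
    IsGraphMinor (G.contract a b) G := by
  refine ⟨fun x => {v | v = x.1 ∨ (x.1 = a ∧ v = b)}, fun x => ?_, fun x y hxy => ?_,
    fun x y hxy => ?_⟩
  · by_cases hx : x.1 = a
    · have : {v | v = x.1 ∨ (x.1 = a ∧ v = b)} = {a, b} := by
        ext v; simp [hx]
      show (G.induce {v | v = x.1 ∨ (x.1 = a ∧ v = b)}).Connected
      rw [this]
      exact induce_pair_connected_of_adj hab
    · have : {v | v = x.1 ∨ (x.1 = a ∧ v = b)} = {x.1} := by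
        ext v; simp [hx]
      show (G.induce {v | v = x.1 ∨ (x.1 = a ∧ v = b)}).Connected
      rw [this]
      have : Subsingleton ({x.1} : Set V) := by simp
      exact Connected.of_subsingleton
  · rw [Set.disjoint_left]
    have hxy' : x.1 ≠ y.1 := fun h => hxy (Subtype.ext h)
    have hx := x.2
    have hy := y.2
    rintro v (h | ⟨h, h'⟩) (h'' | ⟨h'', h'''⟩) <;> grind
  · obtain ⟨-, h | ⟨h, h'⟩ | ⟨h, h'⟩⟩ := hxy
    · exact ⟨x, Or.inl rfl, y, Or.inl rfl, h⟩
    · exact ⟨b, Or.inr ⟨h, rfl⟩, y, Or.inl rfl, h'⟩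
    · exact ⟨x, Or.inl rfl, b, Or.inr ⟨h, rfl⟩, h'⟩

/-- The only edges lost are `ab` and, for each common neighbour `c`, the edge `bc`, which merges
with `ac`. Ordered pairs count each twice; these are the pairs in `bad`, off which the contraction
map is injective. -/
theorem ncard_adjPairs_le_contract [Finite V] {G : SimpleGraph V} {a b : V} (hab : G.Adj a b) :
    G.adjPairs.ncard ≤ (G.contract a b).adjPairs.ncard +
      2 * ((G.neighborSet a ∩ G.neighborSet b).ncard + 1) := by
  classical
  set M := insert a (G.neighborSet a ∩ G.neighborSet b) with hM
  set bad : Set (V × V) := (fun c => (b, c)) '' M ∪ (fun c => (c, b)) '' M with hbad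
  have hbadc : bad.ncard ≤ 2 * ((G.neighborSet a ∩ G.neighborSet b).ncard + 1) := by
    have h1 := Set.ncard_union_le ((fun c => (b, c)) '' M) ((fun c => (c, b)) '' M)
    have h2 : ((fun c => (b, c)) '' M).ncard ≤ M.ncard := Set.ncard_image_le
    have h3 : ((fun c => (c, b)) '' M).ncard ≤ M.ncard := Set.ncard_image_le
    have h4 : M.ncard ≤ _ := Set.ncard_insert_le a (G.neighborSet a ∩ G.neighborSet b)
    have h5 : bad.ncard ≤ _ := h1
    omega
  have hmem : ∀ x y, (x, y) ∈ bad ↔ (x = b ∧ y ∈ M) ∨ (y = b ∧ x ∈ M) := by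
    intro x y
    simp only [hbad, Set.mem_union, Set.mem_image, Prod.mk.injEq]
    grind
  have hM' : ∀ c, c ∈ M ↔ c = a ∨ (G.Adj a c ∧ G.Adj b c) := fun c => Iff.rfl
  have hne := hab.ne
  let φ : V → {x // x ≠ b} := fun v => if h : v = b then ⟨a, hne⟩ else ⟨v, h⟩
  have hφb : φ b = ⟨a, hne⟩ := by simp [φ]
  have hφ : ∀ v (h : v ≠ b), φ v = ⟨v, h⟩ := fun v h => by simp [φ, h]
  have hφval : ∀ v, (φ v).1 = if v = b then a else v := fun v => by
    by_cases h : v = b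
    · simp [h, hφb]
    · simp [h, hφ]
  have hinj : (G.adjPairs \ bad).ncard ≤ (G.contract a b).adjPairs.ncard := by
    refine Set.ncard_le_ncard_of_injOn (fun p => (φ p.1, φ p.2)) ?_ ?_
    · rintro ⟨x, y⟩ ⟨hxy, hb⟩
      rw [hmem, hM', hM'] at hb
      have hxy : G.Adj x y := hxy
      have h1 := hφval x
      have h2 := hφval y
      have h3 := hxy.ne
      have h4 := hxy.symm
      show (G.contract a b).Adj (φ x) (φ y)
      refine ⟨fun h => ?_, ?_⟩
      · rw [h] at h1
        grind
      · rw [h1, h2]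
        grind
    · rintro ⟨x, y⟩ ⟨hxy, hb⟩ ⟨x', y'⟩ ⟨hxy', hb'⟩ h
      rw [hmem, hM', hM'] at hb hb'
      have hxy : G.Adj x y := hxy
      have hxy' : G.Adj x' y' := hxy'
      have h1 := hφval x
      have h2 := hφval y
      have h3 := hφval x'
      have h4 := hφval y'
      have h5 := hxy.symm
      have h6 := hxy'.symm
      have h7 : φ x = φ x' := congrArg Prod.fst h
      have h8 : φ y = φ y' := congrArg Prod.snd h
      rw [← h7] at h3
      rw [← h8] at h4
      have h9 := hxy.ne
      have h10 := hxy'.ne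
      rw [Prod.mk.injEq]
      grind
  have h1 : G.adjPairs.ncard ≤ ((G.adjPairs \ bad) ∪ bad).ncard :=
    Set.ncard_le_ncard fun p hp => by
      by_cases h : p ∈ bad
      · exact Or.inr h
      · exact Or.inl ⟨hp, h⟩
  have h2 := Set.ncard_union_le (G.adjPairs \ bad) bad
  omega

theorem ncard_adjPairs_le_induce_of_isolated [Finite V] {G : SimpleGraph V} {b : V}
    (hb : ∀ v, ¬ G.Adj b v) : G.adjPairs.ncard ≤ (G.induce {b}ᶜ).adjPairs.ncard := by
  have : G.adjPairs ⊆ Prod.map Subtype.val Subtype.val '' (G.induce {b}ᶜ).adjPairs := by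
    rintro ⟨x, y⟩ hxy
    have hxy : G.Adj x y := hxy
    refine ⟨(⟨x, ?_⟩, ⟨y, ?_⟩), hxy, rfl⟩
    · rintro rfl; exact hb _ hxy
    · rintro rfl; exact hb _ hxy.symm
  exact (Set.ncard_le_ncard this).trans Set.ncard_image_le

theorem ncard_adjPairs_le_deleteEdges [Finite V] (G : SimpleGraph V) (a b : V) :
    G.adjPairs.ncard ≤ (G.deleteEdges {s(a, b)}).adjPairs.ncard + 2 := by
  have h1 : G.adjPairs ⊆ (G.deleteEdges {s(a, b)}).adjPairs ∪ {(a, b), (b, a)} := by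
    rintro ⟨x, y⟩ hxy
    have hxy : G.Adj x y := hxy
    by_cases h : s(x, y) = s(a, b)
    · right
      simpa using h
    · left
      show (G.deleteEdges {s(a, b)}).Adj x y
      simp only [deleteEdges_adj, Set.mem_singleton_iff]
      exact ⟨hxy, h⟩
  have h2 := Set.ncard_le_ncard h1
  have h3 := Set.ncard_union_le (G.deleteEdges {s(a, b)}).adjPairs {(a, b), (b, a)}
  have h4 : ({(a, b), (b, a)} : Set (V × V)).ncard ≤ 2 := (Set.ncard_insert_le _ _).trans (by simp)
  omega

theorem ncard_adjPairs_eq_sum [Fintype V] (G : SimpleGraph V) :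
    G.adjPairs.ncard = ∑ v, (G.neighborSet v).ncard := by
  classical
  have h1 : G.adjPairs.ncard = (Finset.univ.filter fun p : V × V => G.Adj p.1 p.2).card := by
    rw [← Set.ncard_coe_finset]
    congr 1
    ext p
    simp [adjPairs]
  have h2 : ∀ v, (G.neighborSet v).ncard = (Finset.univ.filter fun w => G.Adj v w).card := by
    intro v
    rw [← Set.ncard_coe_finset]
    congr 1
    ext p
    simp
  simp_rw [h1, h2, Finset.card_filter]
  exact Fintype.sum_prod_type _

/-- Induction on the order, and for fixed order on the bound `P` for the number of ordered adjacent
pairs. Once no deletion or contraction preserves the density, every edge lies in at least `k`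
triangles and some vertex has degree at most `2 * k`; its neighbourhood is dense. -/
theorem isGraphMinor_top_of_many_edges {k m q L : ℕ} (hL : 2 * k < 2 ^ L)
    (hm : q * (12 * L + 1) ≤ m) (hk : 4 * m < k) (n : ℕ) :
    ∀ (P : ℕ) (V : Type*) [Finite V] [Nonempty V] (G : SimpleGraph V),
      Nat.card V = n → G.adjPairs.ncard ≤ P → 2 * k * Nat.card V ≤ G.adjPairs.ncard →
      IsGraphMinor (⊤ : SimpleGraph (Fin q)) G := by
  induction n with
  | zero =>
    intro P V _ _ G hn
    have : 0 < Nat.card V := Nat.card_pos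
    omega
  | succ n ih =>
    intro P
    induction P with
    | zero =>
      intro V _ _ G hn hP hG
      have : 0 < 2 * k * Nat.card V := Nat.mul_pos (by omega) (by omega)
      omega
    | succ P ihP =>
    intro V _ _ G hn hP' hG
    have := Fintype.ofFinite V
    have hpos : 0 < Nat.card V := Nat.card_pos
    have hP : 0 < G.adjPairs.ncard := by
      have : 0 < 2 * k * Nat.card V := by
        apply Nat.mul_pos _ hpos
        omega
      omega
    obtain ⟨⟨a₀, b₀⟩, hab₀⟩ := (Set.ncard_pos).1 hP
    have hab₀ : G.Adj a₀ b₀ := hab₀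
    by_cases hdel : 2 * k * Nat.card V + 2 ≤ G.adjPairs.ncard
    · have h1 := G.ncard_adjPairs_le_deleteEdges a₀ b₀
      have h2 : (G.deleteEdges {s(a₀, b₀)}).adjPairs.ncard < G.adjPairs.ncard := by
        refine Set.ncard_lt_ncard ⟨fun p hp => (G.deleteEdges_le _) hp, fun h => ?_⟩
        have h3 : (G.deleteEdges {s(a₀, b₀)}).Adj a₀ b₀ := @h (a₀, b₀) hab₀
        simp at h3
      refine (ihP V (G.deleteEdges {s(a₀, b₀)}) hn (by omega) (by omega)).trans ?_
      exact .of_injective (Hom.ofLE (G.deleteEdges_le _)) (fun _ _ h => h)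
    have hcardb : ∀ b : V, Nat.card {x // x ≠ b} + 1 = Nat.card V := by
      intro b
      classical
      rw [Nat.card_eq_fintype_card, Nat.card_eq_fintype_card, Fintype.card_subtype_compl]
      simp only [Fintype.card_unique]
      rw [Nat.card_eq_fintype_card] at hpos
      omega
    by_cases hiso : ∃ b, ∀ v, ¬ G.Adj b v
    · obtain ⟨b, hb⟩ := hiso
      have h1 := ncard_adjPairs_le_induce_of_isolated hb
      have h2 : Nat.card ({b}ᶜ : Set V) + 1 = Nat.card V := hcardb b
      have : Nonempty ({b}ᶜ : Set V) := ⟨⟨a₀, fun h => hb b₀ (h ▸ hab₀)⟩⟩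
      have h4 : 2 * k * Nat.card ({b}ᶜ : Set V) ≤ 2 * k * Nat.card V :=
        Nat.mul_le_mul_left _ (by omega)
      refine (ih _ _ (G.induce {b}ᶜ) (by omega) le_rfl (by omega)).trans ?_
      exact .of_injective (Embedding.induce (G := G) {b}ᶜ).toHom Subtype.val_injective
    by_cases hcon : ∃ a b, G.Adj a b ∧ (G.neighborSet a ∩ G.neighborSet b).ncard < k
    · obtain ⟨a, b, hab, hlt⟩ := hcon
      have h1 := ncard_adjPairs_le_contract hab
      have h2 := hcardb b
      have : Nonempty {x // x ≠ b} := ⟨⟨a, hab.ne⟩⟩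
      have h4 : 2 * k * Nat.card V = 2 * k * Nat.card {x // x ≠ b} + 2 * k := by
        rw [← h2]; ring
      refine (ih _ _ (G.contract a b) (by omega) le_rfl (by omega)).trans
        (isGraphMinor_contract hab)
    push Not at hcon hiso
    -- Fewer than `2 * k * n + 2` ordered pairs remain and `n ≥ 2`, so not all degrees can exceed `2
    -- * k`.
    have hv : ∃ v, (G.neighborSet v).ncard ≤ 2 * k := by
      by_contra! h
      have h1 : Fintype.card V * (2 * k + 1) ≤ ∑ v, (G.neighborSet v).ncard := by
        rw [← smul_eq_mul, ← Finset.card_univ]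
        exact Finset.card_nsmul_le_sum _ _ _ fun u _ => h u
      rw [← ncard_adjPairs_eq_sum, ← Nat.card_eq_fintype_card, mul_add, mul_comm _ (2 * k)] at h1
      have h2 := hcardb a₀
      have : 0 < Nat.card {x // x ≠ a₀} := Nat.card_pos_iff.2 ⟨⟨⟨b₀, hab₀.ne'⟩⟩, inferInstance⟩
      omega
    obtain ⟨v, hv⟩ := hv
    have hne : Nonempty (G.neighborSet v) := Set.Nonempty.to_subtype (hiso v)
    have h1 : IsGraphMinor (⊤ : SimpleGraph (Fin q)) (G.induce (G.neighborSet v)) := by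
      refine isGraphMinor_top_of_dense (k := k) (fun u => ?_) ?_ hL hm hk
      · rw [ncard_neighborSet_induce, Set.inter_comm]
        exact hcon v u u.2
      · rwa [Nat.card_coe_set_eq]
    exact h1.trans (.of_injective (Embedding.induce _).toHom Subtype.val_injective)

theorem exists_ncard_neighborSet_lt {V : Type*} [Finite V] [Nonempty V] {k m q L : ℕ}
    (hL : 2 * k < 2 ^ L)
    (hm : q * (12 * L + 1) ≤ m) (hk : 4 * m < k) {G : SimpleGraph V}
    (hG : IsCliqueMinorFree q G) : ∃ v, (G.neighborSet v).ncard < 2 * k := by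
  have := Fintype.ofFinite V
  by_contra! h
  refine hG (isGraphMinor_top_of_many_edges hL hm hk _ _ V G rfl le_rfl ?_)
  rw [ncard_adjPairs_eq_sum, mul_comm, ← smul_eq_mul, Nat.card_eq_fintype_card, ← Finset.card_univ]
  exact Finset.card_nsmul_le_sum _ _ _ fun u _ => h u

theorem exists_coloring_of_degenerate {V : Type*} [Finite V] {G : SimpleGraph V} {d : ℕ}
    (h : ∀ S : Set V, S.Nonempty → ∃ v ∈ S, (G.neighborSet v ∩ S).ncard < d) :
    ∃ c : V → Fin d, ∀ v w, G.Adj v w → c v ≠ c w := by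
  classical
  rcases isEmpty_or_nonempty V with hV | hV
  · exact ⟨fun v => hV.elim v, fun v => hV.elim v⟩
  have key : ∀ (n : ℕ) (S : Set V), S.ncard = n →
      ∃ c : V → Fin d, ∀ v ∈ S, ∀ w ∈ S, G.Adj v w → c v ≠ c w := by
    intro n
    induction n with
    | zero =>
      intro S hS
      obtain ⟨v, -, hv⟩ := h Set.univ Set.univ_nonempty
      rw [Set.ncard_eq_zero] at hS
      subst hS
      exact ⟨fun _ => ⟨0, by omega⟩, by simp⟩
    | succ n ih =>
      intro S hS
      obtain ⟨v, hvS, hv⟩ := h S ((Set.ncard_pos).1 (by omega))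
      obtain ⟨c, hc⟩ := ih (S \ {v}) (by rw [Set.ncard_sdiff_singleton_of_mem hvS]; omega)
      have h1 : ((c '' (G.neighborSet v ∩ S)) : Set (Fin d)).ncard < (Set.univ : Set (Fin d)).ncard := by
        rw [Set.ncard_univ, Nat.card_fin]
        exact lt_of_le_of_lt (Set.ncard_image_le) hv
      obtain ⟨x, -, hx⟩ := Set.exists_mem_notMem_of_ncard_lt_ncard h1
      refine ⟨Function.update c v x, fun u hu w hw huw => ?_⟩
      rcases eq_or_ne u v with rfl | huv
      · rw [Function.update_self, Function.update_of_ne huw.ne']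
        exact fun h => hx ⟨w, ⟨huw, hw⟩, h.symm⟩
      · rcases eq_or_ne w v with rfl | hwv
        · rw [Function.update_self, Function.update_of_ne huv]
          exact fun h => hx ⟨u, ⟨huw.symm, hu⟩, h⟩
        · rw [Function.update_of_ne huv, Function.update_of_ne hwv]
          exact hc u ⟨hu, huv⟩ w ⟨hw, hwv⟩ huw
  obtain ⟨c, hc⟩ := key _ Set.univ rfl
  exact ⟨c, fun v w => hc v trivial w trivial⟩

end SimpleGraph

/-! ### Flow labels and cuts -/

namespace MulticastNetwork

variable {V E : Type*}

theorem topology_adj_of_link {N : MulticastNetwork V E} (hN : N.IsAcyclic) (e : E) :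
    N.topology.Adj (N.tail e) (N.head e) := by
  have hl : N.Link (N.tail e) (N.head e) := ⟨e, rfl, rfl⟩
  refine (SimpleGraph.fromRel_adj _ _ _).2 ⟨fun h => ?_, Or.inl hl⟩
  rw [← h] at hl
  exact hN _ (.single hl)

theorem IsAcyclic.wellFounded [Finite V] {N : MulticastNetwork V E} (hN : N.IsAcyclic) :
    WellFounded N.Link := by
  have : Std.Irrefl (Relation.TransGen N.Link) := ⟨hN⟩
  exact Subrelation.wf (fun h => Relation.TransGen.single h)
    (Finite.wellFounded_of_trans_of_irrefl (Relation.TransGen N.Link))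

/-- Given the sets `I v` of flows entering the nodes, the link `e` carries the flow `c`: a link
leaving the source or a node entered by several flows starts a flow of its own, every other link
forwards the flow entering its tail. -/
def Carries (N : MulticastNetwork V E) (I : V → Set E) (e c : E) : Prop :=
  ((N.tail e = N.source ∨ ¬ (I (N.tail e)).Subsingleton) ∧ c = e) ∨
    (N.tail e ≠ N.source ∧ (I (N.tail e)).Subsingleton ∧ c ∈ I (N.tail e))

/-- `I v` is the set of flows entering the node `v`. -/
def IsFlowAssignment (N : MulticastNetwork V E) (I : V → Set E) : Prop :=
  ∀ v c, c ∈ I v ↔ ∃ e, N.head e = v ∧ N.Carries I e c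

theorem IsAcyclic.exists_isFlowAssignment [Finite V] {N : MulticastNetwork V E}
    (hN : N.IsAcyclic) : ∃ I, N.IsFlowAssignment I := by
  let F : (v : V) → ((u : V) → N.Link u v → Set E) → Set E := fun v I =>
    {c | ∃ (e : E) (h : N.head e = v),
      ((N.tail e = N.source ∨ ¬ (I (N.tail e) ⟨e, rfl, h⟩).Subsingleton) ∧ c = e) ∨
      (N.tail e ≠ N.source ∧ (I (N.tail e) ⟨e, rfl, h⟩).Subsingleton ∧
        c ∈ I (N.tail e) ⟨e, rfl, h⟩)}
  refine ⟨hN.wellFounded.fix F, fun v c => ?_⟩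
  rw [WellFounded.fix_eq]
  simp only [F, Set.mem_ofPred_eq, Carries, exists_prop]

variable {N : MulticastNetwork V E} {I : V → Set E}

theorem carries_self {e : E} (h : N.tail e = N.source ∨ ¬ (I (N.tail e)).Subsingleton) :
    N.Carries I e e := Or.inl ⟨h, rfl⟩

theorem Carries.unique {e c c' : E} (h : N.Carries I e c) (h' : N.Carries I e c') : c = c' := by
  rcases h with ⟨h1, h2⟩ | ⟨h1, h2, h3⟩ <;> rcases h' with ⟨h1', h2'⟩ | ⟨h1', h2', h3'⟩
  · rw [h2, h2']
  · tauto
  · tauto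
  · exact h2 h3 h3'

/-- Let `X` be the set of non-source nodes all of whose flows also enter `t`. A link entering `X`
from outside must start its own flow, since a forwarding tail would itself lie in `X`. That flow
enters `t`, so a cut of size 2 yields two flows at `t`. -/
theorem IsFlowAssignment.not_subsingleton (hI : N.IsFlowAssignment I) {t : V}
    (ht : t ≠ N.source)
    (hcut : ∀ X : Set V, t ∈ X → N.source ∉ X → 2 ≤ {e | N.head e ∈ X ∧ N.tail e ∉ X}.ncard) :
    ¬ (I t).Subsingleton := by
  intro hs
  have h1 := hcut {v | v ≠ N.source ∧ I v ⊆ I t} ⟨ht, subset_rfl⟩ (fun h => h.1 rfl)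
  have h2 : {e | N.head e ∈ {v | v ≠ N.source ∧ I v ⊆ I t} ∧
      N.tail e ∉ {v | v ≠ N.source ∧ I v ⊆ I t}} ⊆ I t := by
    rintro e ⟨⟨-, he⟩, he'⟩
    have hsub : ∀ c, N.Carries I e c → c ∈ I t := fun c hc => he ((hI _ _).2 ⟨e, rfl, hc⟩)
    by_cases hf : N.tail e = N.source ∨ ¬ (I (N.tail e)).Subsingleton
    · exact hsub e (carries_self hf)
    · rw [not_or, not_not] at hf
      refine absurd ⟨hf.1, fun c hc => hsub c (Or.inr ⟨hf.1, hf.2, hc⟩)⟩ he'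
  have h3 := Set.ncard_le_ncard h2 hs.finite
  have := hs.finite.to_subtype
  have h4 := Set.ncard_le_one_iff_subsingleton.2 hs
  omega

/-- The easy half of max-flow min-cut: summing net inflow over `X` leaves only the links crossing
its boundary, and each inward one contributes at most 1. -/
theorem two_le_ncard_cut [Fintype V] [Fintype E] {t : V}
    (hflow : 2 ≤ N.maxFlow t) (X : Set V) (htX : t ∈ X) (hsX : N.source ∉ X) :
    2 ≤ {e | N.head e ∈ X ∧ N.tail e ∉ X}.ncard := by
  classical
  by_contra! hlt
  have hne : {r : ℝ | ∃ f : E → ℝ, N.IsFlow t f ∧ N.netInflow f t = r}.Nonempty :=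
    ⟨0, 0, ⟨fun e => by simp, fun v _ _ => by simp [netInflow]⟩, by simp [netInflow]⟩
  have hle : N.maxFlow t ≤ 1 := by
    refine csSup_le hne ?_
    rintro _ ⟨f, ⟨hf, hcons⟩, rfl⟩
    have h1 : N.netInflow f t = ∑ v with v ∈ X, N.netInflow f v := by
      rw [Finset.sum_eq_single_of_mem t (by simpa using htX)]
      intro v hv hvt
      refine hcons v ?_ hvt
      rintro rfl
      exact hsX (by simpa using hv)
    have h2 : ∀ g : E → V, ∑ v with v ∈ X, ∑ e with g e = v, f e = ∑ e with g e ∈ X, f e := by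
      intro g
      rw [← Finset.sum_fiberwise_of_maps_to (s := Finset.univ.filter fun e => g e ∈ X)
        (t := Finset.univ.filter fun v => v ∈ X) (g := g) (by simp)]
      refine Finset.sum_congr rfl fun v hv => Finset.sum_congr ?_ fun _ _ => rfl
      ext e
      simp only [Finset.mem_filter, Finset.mem_univ, true_and] at hv ⊢
      exact ⟨fun h => ⟨h ▸ hv, h⟩, fun h => h.2⟩
    rw [h1]
    simp only [netInflow, Finset.sum_sub_distrib]
    rw [h2, h2, Finset.sum_filter, Finset.sum_filter, ← Finset.sum_sub_distrib]
    have h3 : ∀ e, ((if N.head e ∈ X then f e else 0) - (if N.tail e ∈ X then f e else 0)) ≤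
        if e ∈ {e | N.head e ∈ X ∧ N.tail e ∉ X} then 1 else 0 := by
      intro e
      have := hf e
      by_cases h : N.head e ∈ X <;> by_cases h' : N.tail e ∈ X <;> simp [h, h', this]
    refine (Finset.sum_le_sum fun e _ => h3 e).trans ?_
    rw [← Finset.sum_filter, Finset.sum_const, nsmul_eq_mul, mul_one]
    have h4 : (Finset.univ.filter fun e => e ∈ {e | N.head e ∈ X ∧ N.tail e ∉ X}).card =
        {e | N.head e ∈ X ∧ N.tail e ∉ X}.ncard := by
      rw [← Set.ncard_coe_finset]
      congr 1
      ext e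
      simp
    rw [h4]
    exact_mod_cast Nat.lt_succ_iff.1 hlt
  linarith

/-! ### Regions and the conflict graph -/

/-- The nodes entered by exactly the flow `c`. -/
def region (N : MulticastNetwork V E) (I : V → Set E) (c : E) : Set V :=
  {v | v ≠ N.source ∧ I v = {c}}

/-- The nodes other than the source that are entered by at least two flows. -/
def mixing (N : MulticastNetwork V E) (I : V → Set E) : Set V :=
  {v | v ≠ N.source ∧ ¬ (I v).Subsingleton}

theorem IsFlowAssignment.exists_link (hI : N.IsFlowAssignment I) {c : E} {v : V} (hc : c ∈ I v) :
    v = N.head c ∨ ∃ e, N.head e = v ∧ N.tail e ∈ N.region I c := by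
  obtain ⟨e, he, ⟨-, h⟩ | ⟨h1, h2, h3⟩⟩ := (hI v c).1 hc
  · left; rw [h, he]
  · exact Or.inr ⟨e, he, h1, h2.eq_singleton_of_mem h3⟩

theorem IsFlowAssignment.head_mem_region [Finite V] (hI : N.IsFlowAssignment I)
    (hN : N.IsAcyclic) (c : E) (v : V) (hv : v ∈ N.region I c) :
    ∃ h : N.head c ∈ N.region I c,
      (N.topology.induce (N.region I c)).Reachable ⟨N.head c, h⟩ ⟨v, hv⟩ := by
  induction v using hN.wellFounded.induction with
  | _ v ih =>
    rcases hI.exists_link (show c ∈ I v by rw [hv.2]; rfl) with h | ⟨e, he, het⟩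
    · subst h
      exact ⟨hv, .refl _⟩
    · obtain ⟨h, hr⟩ := ih (N.tail e) ⟨e, rfl, he⟩ het
      refine ⟨h, hr.trans (SimpleGraph.Adj.reachable ?_)⟩
      have := topology_adj_of_link hN e
      rwa [he] at this

theorem IsFlowAssignment.connected_region [Finite V] (hI : N.IsFlowAssignment I)
    (hN : N.IsAcyclic) {c : E} (hc : (N.region I c).Nonempty) :
    (N.topology.induce (N.region I c)).Connected := by
  obtain ⟨v, hv⟩ := hc
  obtain ⟨h, -⟩ := hI.head_mem_region hN c v hv
  rw [SimpleGraph.connected_iff_exists_forall_reachable]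
  exact ⟨⟨_, h⟩, fun w => (hI.head_mem_region hN c w w.2).2⟩

/-- A nonempty region contains `N.head c`, which therefore is not mixing. So `c` reaches `u` by
being forwarded from inside the region. -/
theorem IsFlowAssignment.exists_adj_region [Finite V] (hI : N.IsFlowAssignment I)
    (hN : N.IsAcyclic) {c : E} (hc : (N.region I c).Nonempty) {u : V} (hu : u ∈ N.mixing I)
    (hcu : c ∈ I u) : ∃ x ∈ N.region I c, N.topology.Adj x u := by
  rcases hI.exists_link hcu with h | ⟨e, he, het⟩
  · obtain ⟨v, hv⟩ := hc
    obtain ⟨h', -⟩ := hI.head_mem_region hN c v hv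
    rw [← h] at h'
    refine absurd ?_ hu.2
    rw [h'.2]
    exact Set.subsingleton_singleton
  · exact ⟨_, het, he ▸ topology_adj_of_link hN e⟩

/-- The graph on the flows that joins, for each mixing node `u`, the flows `A u` and `B u`. -/
def conflictGraph (N : MulticastNetwork V E) (I : V → Set E) (A B : V → E) : SimpleGraph E :=
  SimpleGraph.fromRel fun a b => ∃ u ∈ N.mixing I, A u = a ∧ B u = b

theorem conflictGraph_adj {A B : V → E} {a b : E} : (N.conflictGraph I A B).Adj a b ↔
    a ≠ b ∧ ((∃ u ∈ N.mixing I, A u = a ∧ B u = b) ∨ ∃ u ∈ N.mixing I, A u = b ∧ B u = a) :=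
  SimpleGraph.fromRel_adj _ _ _

/-- The branch set of `c` is its region with the mixing nodes `u` such that `A u = c`. Such a `u`
also touches the region of `B u`, which realises the conflict. -/
theorem IsFlowAssignment.isGraphMinor_conflictGraph [Finite V] (hI : N.IsFlowAssignment I)
    (hN : N.IsAcyclic) {A B : V → E} (hA : ∀ u ∈ N.mixing I, A u ∈ I u)
    (hB : ∀ u ∈ N.mixing I, B u ∈ I u) {S : Set E} (hS : ∀ c ∈ S, (N.region I c).Nonempty) :
    IsGraphMinor ((N.conflictGraph I A B).induce S) N.topology := by
  have hdisj : ∀ c, ∀ u ∈ N.mixing I, u ∉ N.region I c := by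
    intro c u hu hu'
    apply hu.2
    rw [hu'.2]
    exact Set.subsingleton_singleton
  have hadj : ∀ c c' : S, (∃ u ∈ N.mixing I, A u = c ∧ B u = c') →
      ∃ x ∈ N.region I c ∪ {u | u ∈ N.mixing I ∧ A u = c},
      ∃ y ∈ N.region I c' ∪ {u | u ∈ N.mixing I ∧ A u = c'}, N.topology.Adj x y := by
    rintro c c' ⟨u, hu, h1, h2⟩
    obtain ⟨x, hx, hxu⟩ := hI.exists_adj_region hN (hS c' c'.2) hu (h2 ▸ hB u hu)
    exact ⟨u, Or.inr ⟨hu, h1⟩, x, Or.inl hx, hxu.symm⟩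
  refine ⟨fun c => N.region I c ∪ {u | u ∈ N.mixing I ∧ A u = c}, fun c => ?_,
    fun c c' h => ?_, fun c c' h => ?_⟩
  · have hc := hI.connected_region hN (hS c c.2)
    obtain ⟨⟨v, hv⟩⟩ := hc.nonempty
    refine SimpleGraph.induce_connected_of_patches v (Or.inl hv) ?_
    rintro u (hu | ⟨hu, hAu⟩)
    · exact ⟨_, Set.subset_union_left, hv, hu, hc.preconnected _ _⟩
    · obtain ⟨x, hx, hxu⟩ := hI.exists_adj_region hN (hS c c.2) hu (hAu ▸ hA u hu)
      have hss : Subsingleton ({u} : Set V) := by simp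
      have h1 := SimpleGraph.connected_induce_union (t := {u}) hc.preconnected
        SimpleGraph.Preconnected.of_subsingleton hx rfl hxu
      refine ⟨N.region I c ∪ {u}, Set.union_subset_union_right _ ?_, Or.inl hv, Or.inr rfl, h1.preconnected _ _⟩
      rintro _ rfl
      exact ⟨hu, hAu⟩
  · have h' : c.1 ≠ c'.1 := fun h' => h (Subtype.ext h')
    rw [Set.disjoint_left]
    rintro u (hu | hu) (hu' | hu')
    · exact h' (Set.singleton_injective (hu.2.symm.trans hu'.2))
    · exact hdisj _ _ hu'.1 hu
    · exact hdisj _ _ hu.1 hu'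
    · exact h' (hu.2.symm.trans hu'.2)
  · obtain ⟨-, h | h⟩ := conflictGraph_adj.1 (show (N.conflictGraph I A B).Adj c c' from h)
    · exact hadj c c' h
    · obtain ⟨x, hx, y, hy, hxy⟩ := hadj c' c h
      exact ⟨y, hy, x, hx, hxy.symm⟩

/-- A flow with empty region enters no node but `N.head c`, so it can conflict only there. -/
theorem IsFlowAssignment.ncard_neighborSet_le_one (hI : N.IsFlowAssignment I) {A B : V → E}
    (hA : ∀ u ∈ N.mixing I, A u ∈ I u) (hB : ∀ u ∈ N.mixing I, B u ∈ I u) {c : E}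
    (hc : ¬ (N.region I c).Nonempty) :
    ((N.conflictGraph I A B).neighborSet c).ncard ≤ 1 := by
  have hhead : ∀ u, c ∈ I u → u = N.head c := by
    intro u hu
    rcases hI.exists_link hu with h | ⟨e, -, h⟩
    · exact h
    · exact absurd ⟨_, h⟩ hc
  have hsub : ((N.conflictGraph I A B).neighborSet c).Subsingleton := by
    intro x hx y hy
    obtain ⟨hx1, hx2⟩ := conflictGraph_adj.1 (show (N.conflictGraph I A B).Adj c x from hx)
    obtain ⟨hy1, hy2⟩ := conflictGraph_adj.1 (show (N.conflictGraph I A B).Adj c y from hy)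
    have key : ∀ z, ((∃ u ∈ N.mixing I, A u = c ∧ B u = z) ∨
        ∃ u ∈ N.mixing I, A u = z ∧ B u = c) →
        (A (N.head c) = c ∧ B (N.head c) = z) ∨ (A (N.head c) = z ∧ B (N.head c) = c) := by
      rintro z (⟨u, hu, h1, h2⟩ | ⟨u, hu, h1, h2⟩)
      · rw [← hhead u (h1 ▸ hA u hu)]; exact Or.inl ⟨h1, h2⟩
      · rw [← hhead u (h2 ▸ hB u hu)]; exact Or.inr ⟨h1, h2⟩
    have h3 := key x hx2
    have h4 := key y hy2
    grind
  have := hsub.finite.to_subtype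
  exact Set.ncard_le_one_iff_subsingleton.2 hsub

/-! ### From a colouring to a linear code -/

theorem span_pair_eq_top {F : Type*} [Field F] {x y : F} (hxy : x ≠ y) {S : Set (Fin 2 → F)}
    (hx : ![1, x] ∈ S) (hy : ![1, y] ∈ S) : Submodule.span F S = ⊤ := by
  rw [eq_top_iff]
  rintro z -
  have hne : y - x ≠ 0 := sub_ne_zero.2 hxy.symm
  have hz : z = (z 0 - (z 1 - z 0 * x) / (y - x)) • ![1, x] +
      ((z 1 - z 0 * x) / (y - x)) • ![1, y] := by
    ext i
    fin_cases i
    · simp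
    · simp
      field_simp
      ring
  rw [hz]
  exact Submodule.add_mem _ (Submodule.smul_mem _ _ (Submodule.subset_span hx))
    (Submodule.smul_mem _ _ (Submodule.subset_span hy))

theorem IsFlowAssignment.exists_isLinearSolution (hI : N.IsFlowAssignment I) {A B : V → E}
    (hA : ∀ u ∈ N.mixing I, A u ∈ I u) (hB : ∀ u ∈ N.mixing I, B u ∈ I u)
    (hAB : ∀ u ∈ N.mixing I, A u ≠ B u) (hrec : N.receivers ⊆ N.mixing I)
    {F : Type*} [Field F] (col : E → F)
    (hcol : ∀ a b, (N.conflictGraph I A B).Adj a b → col a ≠ col b) :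
    ∃ vec : E → Fin 2 → F, N.IsLinearSolution 2 F vec := by
  classical
  let vec : E → Fin 2 → F := fun e =>
    -- The value 0 goes to links whose tail is entered by no flow.
    if h : ∃ c, N.Carries I e c then ![1, col h.choose] else 0
  have hvec : ∀ e c, N.Carries I e c → vec e = ![1, col c] := by
    intro e c hc
    have h : ∃ c, N.Carries I e c := ⟨c, hc⟩
    simp only [vec, dif_pos h, h.choose_spec.unique hc]
  have hmem : ∀ u c, c ∈ I u → ![1, col c] ∈ {x | ∃ e', N.head e' = u ∧ vec e' = x} := by
    intro u c hc
    obtain ⟨e, he, hec⟩ := (hI u c).1 hc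
    exact ⟨e, he, hvec e c hec⟩
  have htop : ∀ u ∈ N.mixing I,
      Submodule.span F {x | ∃ e', N.head e' = u ∧ vec e' = x} = ⊤ := by
    intro u hu
    refine span_pair_eq_top (hcol (A u) (B u) ?_) (hmem u _ (hA u hu)) (hmem u _ (hB u hu))
    exact conflictGraph_adj.2 ⟨hAB u hu, Or.inl ⟨u, hu, rfl, rfl⟩⟩
  refine ⟨vec, fun e he => ?_, fun t ht => htop t (hrec ht)⟩
  by_cases hs : (I (N.tail e)).Subsingleton
  · by_cases h : ∃ c, N.Carries I e c
    · obtain ⟨c, hc⟩ := h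
      rw [hvec e c hc]
      rcases hc with ⟨h1 | h1, -⟩ | ⟨-, -, h1⟩
      · exact absurd h1 he
      · exact absurd hs h1
      · exact Submodule.subset_span (hmem _ _ h1)
    · simp only [vec, dif_neg h]
      exact Submodule.zero_mem _
  · rw [htop _ ⟨he, hs⟩]
    trivial

theorem IsAcyclic.exists_linearSolution_zmod [Fintype V] [Fintype E] (hN : N.IsAcyclic)
    (hflow : ∀ t ∈ N.receivers, 2 ≤ N.maxFlow t) {k m q L : ℕ} (hL : 2 * k < 2 ^ L)
    (hm : q * (12 * L + 1) ≤ m) (hk : 4 * m < k) (hq : IsCliqueMinorFree q N.topology)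
    {p : ℕ} [Fact p.Prime] (hp : 2 * k ≤ p) :
    ∃ vec : E → Fin 2 → ZMod p, N.IsLinearSolution 2 (ZMod p) vec := by
  classical
  obtain ⟨I, hI⟩ := hN.exists_isFlowAssignment
  have hrec : N.receivers ⊆ N.mixing I := by
    intro t ht
    have hts : t ≠ N.source := fun h => N.source_notMem (h ▸ ht)
    exact ⟨hts, hI.not_subsingleton hts (two_le_ncard_cut (hflow t ht))⟩
  rcases isEmpty_or_nonempty E with hE | hE
  -- Without links no node is mixing, so there are no receivers.
  · exact ⟨0, fun e => hE.elim e, fun t ht => absurd Set.subsingleton_of_subsingleton (hrec ht).2⟩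
  have hpair : ∀ u, ∃ a b, u ∈ N.mixing I → a ∈ I u ∧ b ∈ I u ∧ a ≠ b := by
    intro u
    by_cases hu : u ∈ N.mixing I
    · obtain ⟨a, ha, b, hb, hab⟩ := Set.not_subsingleton_iff.1 hu.2
      exact ⟨a, b, fun _ => ⟨ha, hb, hab⟩⟩
    · exact ⟨hE.some, hE.some, fun h => absurd h hu⟩
  choose A B hAB using hpair
  have hA : ∀ u ∈ N.mixing I, A u ∈ I u := fun u hu => (hAB u hu).1
  have hB : ∀ u ∈ N.mixing I, B u ∈ I u := fun u hu => (hAB u hu).2.1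
  have hdeg : ∀ S : Set E, S.Nonempty →
      ∃ c ∈ S, ((N.conflictGraph I A B).neighborSet c ∩ S).ncard < 2 * k := by
    intro S hS
    by_cases h : ∀ c ∈ S, (N.region I c).Nonempty
    · have hminor := hI.isGraphMinor_conflictGraph hN hA hB h
      have : Nonempty S := hS.to_subtype
      obtain ⟨c, hc⟩ := SimpleGraph.exists_ncard_neighborSet_lt hL hm hk
        (G := (N.conflictGraph I A B).induce S) (fun hK => hq (hK.trans hminor))
      rw [SimpleGraph.ncard_neighborSet_induce] at hc
      exact ⟨c, c.2, hc⟩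
    · push Not at h
      obtain ⟨c, hcS, hc⟩ := h
      refine ⟨c, hcS, ?_⟩
      have h1 := hI.ncard_neighborSet_le_one hA hB (Set.not_nonempty_iff_eq_empty.2 hc)
      have h2 := Set.ncard_le_ncard
        (Set.inter_subset_left (s := (N.conflictGraph I A B).neighborSet c) (t := S))
      omega
  obtain ⟨col, hcol⟩ := SimpleGraph.exists_coloring_of_degenerate hdeg
  refine hI.exists_isLinearSolution hA hB (fun u hu => (hAB u hu).2.2) hrec
    (fun e => ((col e : ℕ) : ZMod p)) (fun a b hab h => hcol a b hab ?_)
  have h1 := (ZMod.natCast_eq_natCast_iff' _ _ _).1 h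
  rw [Nat.mod_eq_of_lt ((col a).2.trans_le hp), Nat.mod_eq_of_lt ((col b).2.trans_le hp)] at h1
  exact Fin.ext h1

end MulticastNetwork

/-! ### Numerical bounds and conclusion -/

/-- The requirement `2 * k < 2 ^ L` is circular, as `k` grows linearly with `L`. With `a = Nat.clog
2 q` and `L = 13 * a`, the left side is at most `1258 * 4 ^ a` and the right side at least `2048 * 4
^ a`. -/
theorem four_mul_clog_bound {q : ℕ} (hq : 2 ≤ q) :
    2 * (4 * (q * (12 * (13 * Nat.clog 2 q) + 1)) + 1) < 2 ^ (13 * Nat.clog 2 q) := by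
  set a := Nat.clog 2 q
  have h1 : q ≤ 2 ^ a := Nat.le_pow_clog (by norm_num) q
  have h2 : a < 2 ^ a := Nat.lt_two_pow_self
  have h3 : 1 ≤ a := Nat.clog_pos (by norm_num) hq
  have h4 : q * (12 * (13 * a) + 1) ≤ 2 ^ a * (157 * 2 ^ a) := Nat.mul_le_mul h1 (by omega)
  have h5 : (2 : ℕ) ^ (13 * a) = (2 ^ a * 2 ^ a) * (2 ^ 11) ^ a := by
    rw [← pow_mul, ← pow_add, ← pow_add]
    congr 1
    ring
  have h6 : (2 ^ 11) ^ 1 ≤ (2 ^ 11) ^ a := Nat.pow_le_pow_right (by norm_num) h3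
  have h7 : 1 ≤ 2 ^ a * 2 ^ a := Nat.mul_pos (by positivity) (by positivity)
  rw [h5]
  nlinarith

theorem clog_le_three_mul_log {q : ℕ} (hq : 2 ≤ q) : (Nat.clog 2 q : ℝ) ≤ 3 * Real.log q := by
  have h1 : 2 ^ (Nat.clog 2 q).pred < q := Nat.pow_pred_clog_lt_self (by norm_num) (by omega)
  have h3 : 1 ≤ Nat.clog 2 q := Nat.clog_pos (by norm_num) hq
  obtain ⟨b, hb⟩ : ∃ b, Nat.clog 2 q = b + 1 := ⟨Nat.clog 2 q - 1, by omega⟩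
  rw [hb] at h1 ⊢
  have h2 : (b : ℝ) * Real.log 2 ≤ Real.log q := by
    rw [← Real.log_pow]
    apply Real.log_le_log (by positivity)
    exact_mod_cast h1.le
  have h4 : Real.log 2 ≤ Real.log q := Real.log_le_log (by norm_num) (by exact_mod_cast hq)
  have h5 := Real.log_two_gt_d9
  push_cast
  have h6 : (0 : ℝ) ≤ b := by positivity
  nlinarith

theorem corollary1 :
    ∃ C : ℝ, 0 < C ∧
      ∀ (q : ℕ), 2 ≤ q →
      ∀ (V E : Type*) [Fintype V] [Fintype E] (N : MulticastNetwork V E),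
        N.IsAcyclic →
        (∀ t ∈ N.receivers, 2 ≤ N.maxFlow t) →
        IsCliqueMinorFree q N.topology →
        (N.sufficientFieldSizes 2).Nonempty ∧
          (N.minFieldSize 2 : ℝ) ≤ C * (q * Real.log q) := by
  refine ⟨10000, by norm_num, fun q hq V E _ _ N hN hflow hfree => ?_⟩
  set a := Nat.clog 2 q with ha
  set m := q * (12 * (13 * a) + 1) with hm
  -- Bertrand's postulate with `k = 4 * m + 1`: a prime above the `2 * k` colours and at most `4 *
  -- k`.
  obtain ⟨p, hp, hkp, hpk⟩ := Nat.exists_prime_lt_and_le_two_mul (2 * (4 * m + 1)) (by omega)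
  have : Fact p.Prime := ⟨hp⟩
  have hmem : p ∈ N.sufficientFieldSizes 2 :=
    ⟨ZMod p, inferInstance, inferInstance, ZMod.card p,
      hN.exists_linearSolution_zmod hflow (four_mul_clog_bound hq) le_rfl (by omega) hfree hkp.le⟩
  refine ⟨⟨p, hmem⟩, ?_⟩
  have h1 : N.minFieldSize 2 ≤ 4 * (4 * m + 1) := (Nat.sInf_le hmem).trans (by omega)
  have h2 : 4 * (4 * m + 1) ≤ 2516 * (q * a) := by
    have : 1 ≤ a := Nat.clog_pos (by norm_num) hq
    have h3 : q * 1 ≤ q * a := Nat.mul_le_mul_left _ this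
    have h4 : m = 156 * (q * a) + q := by rw [hm]; ring
    omega
  calc (N.minFieldSize 2 : ℝ) ≤ 2516 * (q * a) := by exact_mod_cast h1.trans h2
    _ ≤ 2516 * (q * (3 * Real.log q)) := by
      gcongr
      exact clog_le_three_mul_log hq
    _ ≤ 10000 * (q * Real.log q) := by
      have h5 : 0 ≤ (q : ℝ) * Real.log q := by positivity
      nlinarith
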